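/- Let $\mathcal H$ be a complex Hilbert space, let $N\ge 2$, and let $A_1,\dots,A_N$ be bounded self-adjoint operators on $\mathcal H$ such that $A_iA_j$ is compact whenever $i\ne j$. Let $E_{A_i}(\cdot)$ denote the projection-valued spectral measure of $A_i$, and for $\varepsilon\ge 0$ put $$\mathcal H_\varepsilon=\bigcap_{i=1}^N E_{A_i}([-\varepsilon,\varepsilon])\,\mathcal H ,\qquad \sum_{i=1}^N \mathrm{Ran}(A_i)=\Big\{\sum_{i=1}^N A_ix_i : x_1,\dots,x_N\in\mathcal H\Big\}.$$ Then $\mathcal H_0=\bigcap_{i=1}^N\mathrm{Ker}(A_i)$, and: 1. $\sum_{i=1}^N\mathrm{Ran}(A_i)$ is closed in $\mathcal H$ if and only if $\mathcal H_\varepsilon=\mathcal H_0$ for some $\varepsilon>0$. 2. If $\mathcal H_\varepsilon\ominus\mathcal H_0=\mathcal H_\varepsilon\cap\mathcal H_0^{\perp}$ is finite dimensional for some $\varepsilon>0$, then $\sum_{i=1}^N\mathrm{Ran}(A_i)$ is closed. 3. If $\sum_{i=1}^N\mathrm{Ran}(A_i)$ is closed, then $\sum_{i=1}^N\mathrm{Ran}(A_i)=\mathcal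 H\ominus\mathcal H_0=\mathcal H_0^{\perp}$. -/

import Mathlib

open MeasureTheory Filter Topology
open scoped InnerProductSpace

section SpectralTheory

variable {H : Type*} [NormedAddCommGroup H] [InnerProductSpace ℂ H] [CompleteSpace H]

/-- For self-adjoint `A` and a vector `x`, the positive functional `f ↦ ⟪x, f(A) x⟫` is
integration against a finite Borel measure. -/
theorem exists_scalarSpectralMeasure (A : H →L[ℂ] H) (hA : IsSelfAdjoint A) (x : H) :
    ∃ μ : Measure ℝ, IsFiniteMeasure μ ∧ ∀ f : ℝ → ℝ, Continuous f →
      ⟪x, cfc f A x⟫_ℂ = ((∫ t, f t ∂μ : ℝ) : ℂ) := by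
  let Φ : C(spectrum ℝ A, ℝ) →⋆ₐ[ℝ] (H →L[ℂ] H) := cfcHom (R := ℝ) hA
  let Λ₀ : CompactlySupportedContinuousMap (spectrum ℝ A) ℝ →ₗ[ℝ] ℝ :=
    { toFun := fun f => (⟪x, Φ f.toContinuousMap x⟫_ℂ).re
      map_add' := by
        intro f g
        have : (f + g).toContinuousMap = f.toContinuousMap + g.toContinuousMap := rfl
        simp [this]
      map_smul' := by
        intro c f
        have : (c • f).toContinuousMap = c • f.toContinuousMap := rfl
        simp [this, inner_smul_right_eq_smul] }
  let Λ := PositiveLinearMap.mk₀ Λ₀ (by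
    intro f hf
    have h1 : (0 : C(spectrum ℝ A, ℝ)) ≤ f.toContinuousMap := fun t => hf t
    have h2 : 0 ≤ Φ f.toContinuousMap := by
      simpa [Φ] using cfcHom_mono hA h1
    rw [ContinuousLinearMap.nonneg_iff_isPositive] at h2
    exact h2.re_inner_nonneg_right x)
  have : CompactSpace (spectrum ℝ A) := isCompact_iff_compactSpace.mp (spectrum.isCompact A)
  refine ⟨(RealRMK.rieszMeasure Λ).map Subtype.val, ?_, ?_⟩
  · infer_instance
  · intro f hf
    rw [integral_map (by fun_prop) (by fun_prop)]
    let g : CompactlySupportedContinuousMap (spectrum ℝ A) ℝ :=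
      ⟨⟨fun t => f t, by fun_prop⟩, HasCompactSupport.of_compactSpace _⟩
    have := RealRMK.integral_rieszMeasure Λ g
    have h3 : cfc f A = Φ g.toContinuousMap := cfc_apply f A hA hf.continuousOn
    have h4 : (∫ t, g t ∂(RealRMK.rieszMeasure Λ)) = (⟪x, cfc f A x⟫_ℂ).re := by
      rw [this, h3]; rfl
    change _ = ((∫ t, g t ∂(RealRMK.rieszMeasure Λ) : ℝ) : ℂ)
    rw [h4]
    have h5 : IsSelfAdjoint (cfc f A) := cfc_predicate f A
    have h6 := (ContinuousLinearMap.isSelfAdjoint_iff_isSymmetric.mp h5)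
    have := h6.im_inner_self_apply x
    apply Complex.ext
    · simp
    · rw [Complex.ofReal_im]
      have h7 := h6 x x
      rw [← inner_conj_symm] at h7
      exact Complex.conj_eq_iff_im.mp h7

theorem norm_cfc_sq (A : H →L[ℂ] H) (μ : Measure ℝ) (x : H)
    (hμ : ∀ f : ℝ → ℝ, Continuous f → ⟪x, cfc f A x⟫_ℂ = ((∫ t, f t ∂μ : ℝ) : ℂ))
    (hA : IsSelfAdjoint A) (f : ℝ → ℝ) (hf : Continuous f) :
    ‖cfc f A x‖ ^ 2 = ∫ t, f t ^ 2 ∂μ := by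
  have h5 : IsSelfAdjoint (cfc f A) := cfc_predicate f A
  have h6 := (ContinuousLinearMap.isSelfAdjoint_iff_isSymmetric.mp h5)
  have h1 := hμ (fun t => f t * f t) (by fun_prop)
  rw [cfc_mul f f A hf.continuousOn hf.continuousOn] at h1
  have h2 : ⟪x, (cfc f A * cfc f A) x⟫_ℂ = ⟪cfc f A x, cfc f A x⟫_ℂ := (h6 x (cfc f A x)).symm
  rw [h2, inner_self_eq_norm_sq_to_K] at h1
  simp only [pow_two]
  rw [← pow_two]
  apply Complex.ofReal_injective
  rw [← h1]
  push_cast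
  rfl

theorem exists_projection_of_seq (μ : H → Measure ℝ) [∀ x, IsFiniteMeasure (μ x)]
    (T : ℕ → H →L[ℂ] H) (f : ℕ → ℝ → ℝ) (S : Set ℝ) (hS : MeasurableSet S)
    (hT : ∀ n, IsSelfAdjoint (T n)) (hfm : ∀ n, Measurable (f n)) (hb : ∀ n t, |f n t| ≤ 1)
    (hlim : ∀ t, Tendsto (fun n => f n t) atTop (𝓝 (S.indicator 1 t)))
    (h1 : ∀ n x, (⟪x, T n x⟫_ℂ).re = ∫ t, f n t ∂(μ x))
    (h2 : ∀ n m x, ‖T n x - T m x‖ ^ 2 = ∫ t, (f n t - f m t) ^ 2 ∂(μ x))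
    (h3 : ∀ n x, ‖T n x‖ ^ 2 = ∫ t, (f n t) ^ 2 ∂(μ x)) :
    ∃ P : H →L[ℂ] H, IsStarProjection P ∧ ∀ x, ‖P x‖ ^ 2 = (μ x).real S := by
  have hcau : ∀ x, CauchySeq (fun n => T n x) := by
    intro x
    rw [cauchySeq_iff_tendsto_dist_atTop_0]
    have key : Tendsto (fun p : ℕ × ℕ => ∫ t, (f p.1 t - f p.2 t) ^ 2 ∂(μ x)) atTop
        (𝓝 (∫ _t, (0 : ℝ) ∂(μ x))) := by
      apply tendsto_integral_filter_of_dominated_convergence (fun _ => (4 : ℝ))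
      · filter_upwards with p
        exact (((hfm p.1).sub (hfm p.2)).pow_const 2).aestronglyMeasurable
      · filter_upwards with p
        filter_upwards with t
        have a := abs_le.mp (hb p.1 t)
        have b := abs_le.mp (hb p.2 t)
        rw [Real.norm_eq_abs, abs_of_nonneg (sq_nonneg _)]
        nlinarith
      · exact integrable_const _
      · filter_upwards with t
        rw [← prod_atTop_atTop_eq]
        have a := ((hlim t).comp tendsto_fst).sub ((hlim t).comp (tendsto_snd (f := atTop (α := ℕ)) (g := atTop (α := ℕ))))
        simpa using a.pow 2
    have k2 := (Real.continuous_sqrt.tendsto _).comp key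
    simp only [integral_zero, Real.sqrt_zero] at k2
    refine k2.congr fun p => ?_
    simp only [Function.comp]
    rw [← h2, Real.sqrt_sq (norm_nonneg _), dist_eq_norm]
  choose L hL using fun x => cauchySeq_tendsto_of_complete (hcau x)
  let P : H →L[ℂ] H := continuousLinearMapOfTendsto T (f := L) (tendsto_pi_nhds.mpr hL)
  have hP : ∀ x, Tendsto (fun n => T n x) atTop (𝓝 (P x)) := hL
  have hsymm : P.toLinearMap.IsSymmetric := by
    intro x y
    have a := (hP x).inner (tendsto_const_nhds (x := y)) (𝕜 := ℂ)
    have b := (tendsto_const_nhds (x := x)).inner (hP y) (𝕜 := ℂ)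
    refine tendsto_nhds_unique a (b.congr fun n => ?_)
    exact (ContinuousLinearMap.isSelfAdjoint_iff_isSymmetric.mp (hT n) x y).symm
  have ind : ∀ x, ∫ t, S.indicator (1 : ℝ → ℝ) t ∂(μ x) = (μ x).real S := by
    intro x; rw [integral_indicator_one hS]
  have e1 : ∀ x, (⟪x, P x⟫_ℂ).re = (μ x).real S := by
    intro x
    have a := (Complex.continuous_re.tendsto _).comp
      ((tendsto_const_nhds (x := x)).inner (hP x) (𝕜 := ℂ))
    refine tendsto_nhds_unique a ?_
    rw [← ind]
    have b : Tendsto (fun n => ∫ t, f n t ∂(μ x)) atTop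
        (𝓝 (∫ t, S.indicator (1 : ℝ → ℝ) t ∂(μ x))) := by
      apply tendsto_integral_of_dominated_convergence (fun _ => (1 : ℝ))
      · exact fun n => (hfm n).aestronglyMeasurable
      · exact integrable_const _
      · intro n; filter_upwards with t; exact hb n t
      · filter_upwards with t; exact hlim t
    exact b.congr fun n => (h1 n x).symm
  have e2 : ∀ x, ‖P x‖ ^ 2 = (μ x).real S := by
    intro x
    refine tendsto_nhds_unique ((hP x).norm.pow 2) ?_
    rw [← ind]
    have b : Tendsto (fun n => ∫ t, f n t ^ 2 ∂(μ x)) atTop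
        (𝓝 (∫ t, S.indicator (1 : ℝ → ℝ) t ∂(μ x))) := by
      apply tendsto_integral_of_dominated_convergence (fun _ => (1 : ℝ))
      · exact fun n => ((hfm n).pow_const 2).aestronglyMeasurable
      · exact integrable_const _
      · intro n; filter_upwards with t
        rw [norm_pow]
        exact pow_le_one₀ (norm_nonneg _) (hb n t)
      · filter_upwards with t
        have : S.indicator (1 : ℝ → ℝ) t = S.indicator (1 : ℝ → ℝ) t ^ 2 := by
          by_cases h : t ∈ S <;> simp [h]
        rw [this]
        exact (hlim t).pow 2
    exact b.congr fun n => (h3 n x).symm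
  refine ⟨P, ⟨?_, ContinuousLinearMap.isSelfAdjoint_iff_isSymmetric.mpr hsymm⟩, e2⟩
  have : ((P * P : H →L[ℂ] H) : H →ₗ[ℂ] H) = (P : H →ₗ[ℂ] H) := by
    rw [← ext_inner_map]
    intro x
    have a : ⟪P (P x), x⟫_ℂ = ⟪P x, P x⟫_ℂ := hsymm (P x) x
    have b : ⟪P x, x⟫_ℂ = ⟪x, P x⟫_ℂ := hsymm x x
    have c : (⟪x, P x⟫_ℂ).im = 0 := by
      rw [← inner_conj_symm] at b
      exact Complex.conj_eq_iff_im.mp b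
    change ⟪P (P x), x⟫_ℂ = ⟪P x, x⟫_ℂ
    rw [a, b, inner_self_eq_norm_sq_to_K]
    apply Complex.ext
    · rw [e1, ← e2 x]; norm_cast
    · rw [c]; norm_cast
  exact ContinuousLinearMap.coe_injective this

theorem IsStarProjection.inner_self_apply {P : H →L[ℂ] H} (hP : IsStarProjection P) (x : H) :
    ⟪x, P x⟫_ℂ = ((‖P x‖ ^ 2 : ℝ) : ℂ) := by
  have hs := ContinuousLinearMap.isSelfAdjoint_iff_isSymmetric.mp hP.isSelfAdjoint
  have h1 : P (P x) = P x := congrArg (fun T : H →L[ℂ] H => T x) hP.isIdempotentElem.eq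
  have h2 : ⟪P x, P x⟫_ℂ = ⟪x, P (P x)⟫_ℂ := hs x (P x)
  rw [h1, inner_self_eq_norm_sq_to_K] at h2
  rw [← h2]; push_cast; rfl

theorem IsStarProjection.eq_of_norm_sq {P Q : H →L[ℂ] H} (hP : IsStarProjection P)
    (hQ : IsStarProjection Q) (h : ∀ x, ‖P x‖ ^ 2 = ‖Q x‖ ^ 2) : P = Q := by
  have : (P : H →ₗ[ℂ] H) = (Q : H →ₗ[ℂ] H) := by
    rw [← ext_inner_map]
    intro x
    have a : ⟪P x, x⟫_ℂ = ⟪x, P x⟫_ℂ :=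
      ContinuousLinearMap.isSelfAdjoint_iff_isSymmetric.mp hP.isSelfAdjoint x x
    have b : ⟪Q x, x⟫_ℂ = ⟪x, Q x⟫_ℂ :=
      ContinuousLinearMap.isSelfAdjoint_iff_isSymmetric.mp hQ.isSelfAdjoint x x
    change ⟪P x, x⟫_ℂ = ⟪Q x, x⟫_ℂ
    rw [a, b, hP.inner_self_apply, hQ.inner_self_apply, h]
  exact ContinuousLinearMap.coe_injective this

theorem IsStarProjection.mul_eq_zero_of_norm_sq {P Q : H →L[ℂ] H} (hP : IsStarProjection P)
    (h : ∀ x, ‖P x‖ ^ 2 + ‖Q x‖ ^ 2 ≤ ‖x‖ ^ 2) (x : H) : Q (P x) = 0 := by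
  have h1 : P (P x) = P x := congrArg (fun T : H →L[ℂ] H => T x) hP.isIdempotentElem.eq
  have h2 := h (P x)
  rw [h1] at h2
  have h3 : ‖Q (P x)‖ ^ 2 ≤ 0 := by linarith
  have h4 : ‖Q (P x)‖ ^ 2 = 0 := le_antisymm h3 (sq_nonneg _)
  simpa using h4

theorem norm_sq_sum_projections {P : ℕ → H →L[ℂ] H} (hP : ∀ n, IsStarProjection (P n))
    (ho : ∀ m n, m ≠ n → ∀ x, P m (P n x) = 0) (s : Finset ℕ) (x : H) :
    ‖∑ n ∈ s, P n x‖ ^ 2 = ∑ n ∈ s, ‖P n x‖ ^ 2 := by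
  apply Complex.ofReal_injective
  have h0 : ((‖∑ n ∈ s, P n x‖ ^ 2 : ℝ) : ℂ) = ⟪∑ n ∈ s, P n x, ∑ n ∈ s, P n x⟫_ℂ := by
    rw [inner_self_eq_norm_sq_to_K]; push_cast; rfl
  rw [h0, sum_inner]
  push_cast
  refine Finset.sum_congr rfl fun m hm => ?_
  rw [inner_sum, Finset.sum_eq_single m]
  · rw [inner_self_eq_norm_sq_to_K]; rfl
  · intro n _ hn
    have hs := ContinuousLinearMap.isSelfAdjoint_iff_isSymmetric.mp (hP m).isSelfAdjoint
    have : ⟪P m x, P n x⟫_ℂ = ⟪x, P m (P n x)⟫_ℂ := hs x (P n x)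
    rw [this, ho m n hn.symm, inner_zero_right]
  · intro h; exact absurd hm h

theorem exists_projection (A : H →L[ℂ] H) (hA : IsSelfAdjoint A) (μ : H → Measure ℝ)
    [∀ x, IsFiniteMeasure (μ x)]
    (hμ : ∀ x, ∀ f : ℝ → ℝ, Continuous f → ⟪x, cfc f A x⟫_ℂ = ((∫ t, f t ∂(μ x) : ℝ) : ℂ))
    (S : Set ℝ) (hS : MeasurableSet S) :
    ∃ P : H →L[ℂ] H, IsStarProjection P ∧ ∀ x, ‖P x‖ ^ 2 = (μ x).real S := by
  have huniv : ∀ x, (μ x).real Set.univ = ‖x‖ ^ 2 := by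
    intro x
    have h := norm_cfc_sq A (μ x) x (hμ x) hA (fun _ => 1) continuous_const
    rw [cfc_const_one ℝ A] at h
    simpa using h.symm
  induction S, hS using MeasurableSpace.induction_on_inter
      (borel_eq_generateFrom_isClosed (α := ℝ) ▸ BorelSpace.measurable_eq (α := ℝ))
      isPiSystem_isClosed with
  | empty => exact ⟨0, IsStarProjection.zero _, by simp⟩
  | basic F hF =>
    have hF : IsClosed F := hF
    let δ : ℕ → ℝ := fun n => 1 / ((n : ℝ) + 1)
    have hδ : ∀ n, 0 < δ n := fun n => Nat.one_div_pos_of_nat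
    let f : ℕ → ℝ → ℝ := fun n t => (thickenedIndicator (hδ n) F t : ℝ)
    have hf : ∀ n, Continuous (f n) := fun n =>
      NNReal.continuous_coe.comp (thickenedIndicator (hδ n) F).continuous
    refine exists_projection_of_seq μ (fun n => cfc (f n) A) f F hF.measurableSet
      (fun n => cfc_predicate _ A) (fun n => (hf n).measurable) ?_ ?_ ?_ ?_ ?_
    · intro n t
      rw [abs_of_nonneg (NNReal.coe_nonneg _)]
      exact_mod_cast thickenedIndicator_le_one (hδ n) F t
    · intro t
      have h := tendsto_pi_nhds.mp (thickenedIndicator_tendsto_indicator_closure hδ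
        tendsto_one_div_add_atTop_nhds_zero_nat F) t
      rw [hF.closure_eq] at h
      have h' := (NNReal.continuous_coe.tendsto _).comp h
      have e : ((F.indicator (fun _ => (1 : NNReal)) t : NNReal) : ℝ) = F.indicator 1 t := by
        by_cases ht : t ∈ F <;> simp [ht]
      rw [e] at h'
      exact h'
    · intro n x
      rw [hμ x _ (hf n), Complex.ofReal_re]
    · intro n m x
      rw [← norm_cfc_sq A (μ x) x (hμ x) hA (fun t => f n t - f m t) ((hf n).sub (hf m)),
        cfc_sub (f n) (f m) A (hf n).continuousOn (hf m).continuousOn]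
      rfl
    · intro n x
      exact norm_cfc_sq A (μ x) x (hμ x) hA (f n) (hf n)
  | compl S hS ih =>
    obtain ⟨P, hP, h⟩ := ih
    refine ⟨1 - P, hP.one_sub, fun x => ?_⟩
    have h1 := hP.one_sub.inner_self_apply x
    have h2 : ⟪x, (1 - P) x⟫_ℂ = ((‖x‖ ^ 2 - ‖P x‖ ^ 2 : ℝ) : ℂ) := by
      have : (1 - P) x = x - P x := rfl
      rw [this, inner_sub_right, hP.inner_self_apply, inner_self_eq_norm_sq_to_K]
      push_cast; rfl
    rw [h2] at h1
    have h3 := Complex.ofReal_injective h1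
    rw [← h3, h, measureReal_compl hS, huniv]
  | iUnion s hd hs ih =>
    choose P hP h using ih
    have ho : ∀ m n, m ≠ n → ∀ x, P m (P n x) = 0 := by
      intro m n hmn x
      refine (hP n).mul_eq_zero_of_norm_sq (fun y => ?_) x
      rw [h, h, ← huniv, ← measureReal_union (hd hmn.symm) (hs m)]
      exact measureReal_mono (Set.subset_univ _)
    have hind : ∀ F : Finset ℕ, ∀ t, (∑ n ∈ F, (s n).indicator (1 : ℝ → ℝ) t)
        = (⋃ n ∈ F, s n).indicator (1 : ℝ → ℝ) t := by
      intro F t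
      rw [Finset.indicator_biUnion_apply F s (fun i _ j _ hij => hd hij)]
    have hreal : ∀ F : Finset ℕ, ∀ x, (μ x).real (⋃ n ∈ F, s n) = ∑ n ∈ F, ‖P n x‖ ^ 2 := by
      intro F x
      rw [measureReal_biUnion_finset (fun i _ j _ hij => hd hij) (fun n _ => hs n)]
      exact Finset.sum_congr rfl fun n _ => (h n x).symm
    have hm : ∀ F : Finset ℕ, MeasurableSet (⋃ n ∈ F, s n) :=
      fun F => Finset.measurableSet_biUnion F fun n _ => hs n
    have hint : ∀ F : Finset ℕ, ∀ x, ∫ t, (∑ n ∈ F, (s n).indicator (1 : ℝ → ℝ) t) ∂(μ x)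
        = ∑ n ∈ F, ‖P n x‖ ^ 2 := by
      intro F x
      simp_rw [hind F]
      rw [integral_indicator_one (hm F), hreal]
    have hint2 : ∀ F : Finset ℕ, ∀ x,
        ∫ t, (∑ n ∈ F, (s n).indicator (1 : ℝ → ℝ) t) ^ 2 ∂(μ x) = ∑ n ∈ F, ‖P n x‖ ^ 2 := by
      intro F x
      rw [← hint]
      refine integral_congr_ae (Eventually.of_forall fun t => ?_)
      simp only [hind F]
      by_cases ht : t ∈ ⋃ n ∈ F, s n <;> simp only [ht, Set.indicator_of_mem,
        Set.indicator_of_notMem, not_false_eq_true, Pi.one_apply] <;> norm_num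
    have hle : ∀ N M, N ≤ M → ∀ x, ‖(∑ n ∈ Finset.range M, P n) x - (∑ n ∈ Finset.range N, P n) x‖ ^ 2
        = ∫ t, ((∑ n ∈ Finset.range M, (s n).indicator (1 : ℝ → ℝ) t)
          - ∑ n ∈ Finset.range N, (s n).indicator (1 : ℝ → ℝ) t) ^ 2 ∂(μ x) := by
      intro N M hNM x
      simp only [_root_.sum_apply, ← Finset.sum_Ico_eq_sub _ hNM]
      rw [norm_sq_sum_projections hP ho, hint2]
    refine exists_projection_of_seq μ (fun N => ∑ n ∈ Finset.range N, P n)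
      (fun N t => ∑ n ∈ Finset.range N, (s n).indicator (1 : ℝ → ℝ) t) (⋃ n, s n)
      (MeasurableSet.iUnion hs) (fun N => ?_) (fun N => ?_) ?_ ?_ ?_ ?_ ?_
    · exact isSelfAdjoint_sum _ fun n _ => (hP n).isSelfAdjoint
    · exact Finset.measurable_sum _ fun n _ => measurable_one.indicator (hs n)
    · intro N t
      simp only [hind]
      by_cases ht : t ∈ ⋃ n ∈ Finset.range N, s n <;> simp only [ht, Set.indicator_of_mem,
        Set.indicator_of_notMem, not_false_eq_true, Pi.one_apply] <;> norm_num
    · intro t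
      simp only [hind]
      exact ((tendsto_indicator_biUnion_finset s (1 : ℝ → ℝ) t).mono_right
        (pure_le_nhds _)).comp tendsto_finset_range
    · intro N x
      simp only [_root_.sum_apply]
      rw [hint, inner_sum, Complex.re_sum]
      refine Finset.sum_congr rfl fun n _ => ?_
      rw [(hP n).inner_self_apply, Complex.ofReal_re]
    · intro N M x
      rcases le_total M N with hNM | hNM
      · exact hle M N hNM x
      · rw [norm_sub_rev, hle N M hNM x]
        congr 1; ext t; ring
    · intro N x
      simp only [_root_.sum_apply]
      rw [hint2, norm_sq_sum_projections hP ho]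

/-- A projection-valued measure on the Borel sets of `ℝ`: every Borel set is sent to an orthogonal
projection, `ℝ` is sent to the identity, and the assignment is countably additive in the strong
operator topology. The value on non-Borel sets is irrelevant. -/
structure ProjectionValuedMeasure (H : Type*) [NormedAddCommGroup H] [InnerProductSpace ℂ H]
    [CompleteSpace H] where
  proj : Set ℝ → H →L[ℂ] H
  isStarProjection : ∀ S, MeasurableSet S → IsStarProjection (proj S)
  proj_univ : proj Set.univ = 1
  hasSum_proj : ∀ s : ℕ → Set ℝ, (∀ n, MeasurableSet (s n)) → Pairwise (Function.onFun Disjoint s) →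
    ∀ x, HasSum (fun n => proj (s n) x) (proj (⋃ n, s n) x)

namespace ProjectionValuedMeasure

theorem proj_empty (E : ProjectionValuedMeasure H) : E.proj ∅ = 0 := by
  ext x
  have h := E.hasSum_proj (fun _ => ∅) (fun _ => MeasurableSet.empty)
    (fun _ _ _ => disjoint_bot_left) x
  simpa using h.summable.tendsto_atTop_zero

theorem hasSum_norm_sq (E : ProjectionValuedMeasure H) (s : ℕ → Set ℝ)
    (hs : ∀ n, MeasurableSet (s n)) (hd : Pairwise (Function.onFun Disjoint s)) (x : H) :
    HasSum (fun n => ‖E.proj (s n) x‖ ^ 2) (‖E.proj (⋃ n, s n) x‖ ^ 2) := by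
  have h := Complex.hasSum_re ((E.hasSum_proj s hs hd x).mapL (innerSL ℂ x))
  simpa only [innerSL_apply_apply, (E.isStarProjection _ (hs _)).inner_self_apply,
    (E.isStarProjection _ (MeasurableSet.iUnion hs)).inner_self_apply, Complex.ofReal_re] using h

/-- The finite Borel measure `S ↦ ⟪x, E(S) x⟫ = ‖E(S) x‖²`. -/
noncomputable def diagMeasure (E : ProjectionValuedMeasure H) (x : H) : Measure ℝ :=
  Measure.ofMeasurable (fun S _ => ENNReal.ofReal (‖E.proj S x‖ ^ 2))
    (by simp [E.proj_empty])
    (fun s hs hd => by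
      have h := E.hasSum_norm_sq s hs hd x
      rw [← h.tsum_eq, ENNReal.ofReal_tsum_of_nonneg (fun _ => sq_nonneg _) h.summable])

theorem diagMeasure_apply (E : ProjectionValuedMeasure H) (x : H) {S : Set ℝ}
    (hS : MeasurableSet S) : E.diagMeasure x S = ENNReal.ofReal (‖E.proj S x‖ ^ 2) :=
  Measure.ofMeasurable_apply S hS

instance (E : ProjectionValuedMeasure H) (x : H) : IsFiniteMeasure (E.diagMeasure x) :=
  ⟨by rw [E.diagMeasure_apply x MeasurableSet.univ]; exact ENNReal.ofReal_lt_top⟩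

end ProjectionValuedMeasure

/-- `E` is the projection-valued spectral measure of `A`: `f(A) = ∫ f dE` weakly, for every
continuous `f`, where `f(A)` is the continuous functional calculus. The case `f(t) = t` is
`A = ∫ t dE(t)`. -/
def IsSpectralMeasure (A : H →L[ℂ] H) (E : ProjectionValuedMeasure H) : Prop :=
  ∀ f : ℝ → ℝ, Continuous f → ∀ x : H,
    ⟪x, cfc f A x⟫_ℂ = ((∫ t, f t ∂(E.diagMeasure x) : ℝ) : ℂ)

/-- The spectral measure is unique on Borel sets. -/
theorem IsSpectralMeasure.unique {A : H →L[ℂ] H} {E F : ProjectionValuedMeasure H}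
    (hE : IsSpectralMeasure A E) (hF : IsSpectralMeasure A F) {S : Set ℝ}
    (hS : MeasurableSet S) : E.proj S = F.proj S := by
  refine (E.isStarProjection S hS).eq_of_norm_sq (F.isStarProjection S hS) fun x => ?_
  have h : E.diagMeasure x = F.diagMeasure x := by
    apply ext_of_forall_integral_eq_of_IsFiniteMeasure
    intro f
    exact Complex.ofReal_injective ((hE f f.continuous x).symm.trans (hF f f.continuous x))
  have h2 := congrArg (fun m => m S) h
  simp only [E.diagMeasure_apply x hS, F.diagMeasure_apply x hS] at h2
  exact (ENNReal.ofReal_eq_ofReal_iff (sq_nonneg _) (sq_nonneg _)).mp h2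

/-- Spectral theorem: every bounded self-adjoint operator has a spectral measure. -/
theorem exists_isSpectralMeasure (A : H →L[ℂ] H) (hA : IsSelfAdjoint A) :
    ∃ E : ProjectionValuedMeasure H, IsSpectralMeasure A E := by
  classical
  choose μ hfin hμ using exists_scalarSpectralMeasure A hA
  have huniv : ∀ x, (μ x).real Set.univ = ‖x‖ ^ 2 := by
    intro x
    have h := norm_cfc_sq A (μ x) x (hμ x) hA (fun _ => 1) continuous_const
    rw [cfc_const_one ℝ A] at h
    simpa using h.symm
  choose P hP hn using exists_projection A hA μ hμ
  let Q : Set ℝ → H →L[ℂ] H := fun S => if hS : MeasurableSet S then P S hS else 0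
  have hQ : ∀ S, MeasurableSet S → IsStarProjection (Q S) := fun S hS => by
    simp only [Q, dif_pos hS]; exact hP S hS
  have hQn : ∀ S, MeasurableSet S → ∀ x, ‖Q S x‖ ^ 2 = (μ x).real S := fun S hS x => by
    simp only [Q, dif_pos hS]; exact hn S hS x
  have hadd : ∀ S T, MeasurableSet S → MeasurableSet T → Disjoint S T →
      Q (S ∪ T) = Q S + Q T := by
    intro S T hS hT hd
    have : ((Q (S ∪ T) : H →L[ℂ] H) : H →ₗ[ℂ] H) = ((Q S + Q T : H →L[ℂ] H) : H →ₗ[ℂ] H) := by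
      rw [← ext_inner_map]
      intro x
      have e : ∀ U, MeasurableSet U → ⟪Q U x, x⟫_ℂ = (((μ x).real U : ℝ) : ℂ) := fun U hU => by
        have a : ⟪Q U x, x⟫_ℂ = ⟪x, Q U x⟫_ℂ :=
          ContinuousLinearMap.isSelfAdjoint_iff_isSymmetric.mp (hQ U hU).isSelfAdjoint x x
        rw [a, (hQ U hU).inner_self_apply, hQn U hU]
      change ⟪Q (S ∪ T) x, x⟫_ℂ = ⟪Q S x + Q T x, x⟫_ℂ
      rw [inner_add_left, e _ hS, e _ hT, e _ (hS.union hT), measureReal_union hd hT]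
      push_cast; rfl
    exact ContinuousLinearMap.coe_injective this
  have hempty : Q ∅ = 0 := by
    ext x
    have := hQn ∅ MeasurableSet.empty x
    simpa using this
  have hsum : ∀ s : ℕ → Set ℝ, (∀ n, MeasurableSet (s n)) →
      Pairwise (Function.onFun Disjoint s) → ∀ F : Finset ℕ,
      Q (⋃ n ∈ F, s n) = ∑ n ∈ F, Q (s n) := by
    intro s hs hd F
    induction F using Finset.induction_on with
    | empty => simpa using hempty
    | insert a F ha ih =>
      rw [Finset.set_biUnion_insert, hadd _ _ (hs a) (Finset.measurableSet_biUnion F fun n _ => hs n),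
        ih, Finset.sum_insert ha]
      rw [Set.disjoint_iUnion₂_right]
      intro i hi
      exact hd (fun h => ha (h ▸ hi))
  let E : ProjectionValuedMeasure H :=
    { proj := Q
      isStarProjection := hQ
      proj_univ := by
        refine (hQ _ MeasurableSet.univ).eq_of_norm_sq (IsStarProjection.one _) fun x => ?_
        rw [hQn _ MeasurableSet.univ, huniv]; rfl
      hasSum_proj := by
        intro s hs hd x
        have hU := MeasurableSet.iUnion hs
        have key : ∀ F : Finset ℕ, ‖(∑ n ∈ F, Q (s n) x) - Q (⋃ n, s n) x‖ ^ 2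
            = (μ x).real (⋃ n, s n) - ∑ n ∈ F, (μ x).real (s n) := by
          intro F
          have hm : MeasurableSet (⋃ n ∈ F, s n) := Finset.measurableSet_biUnion F fun n _ => hs n
          have hsub : (⋃ n ∈ F, s n) ⊆ ⋃ n, s n :=
            Set.iUnion₂_subset fun n _ => Set.subset_iUnion s n
          have h1 := hadd _ _ hm (hU.diff hm) Set.disjoint_sdiff_right
          rw [Set.union_sdiff_cancel hsub, hsum s hs hd F] at h1
          rw [h1]
          have h2 : (∑ n ∈ F, Q (s n) x) - (∑ n ∈ F, Q (s n) + Q ((⋃ n, s n) \ ⋃ n ∈ F, s n)) x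
              = - Q ((⋃ n, s n) \ ⋃ n ∈ F, s n) x := by
            simp
          rw [h2, norm_neg, hQn _ (hU.diff hm), measureReal_sdiff hsub hm,
            measureReal_biUnion_finset (fun i _ j _ hij => hd hij) (fun n _ => hs n)]
        have hlim : HasSum (fun n => (μ x).real (s n)) ((μ x).real (⋃ n, s n)) := by
          have h0 := measure_iUnion (μ := μ x) hd hs
          have h1 := ENNReal.hasSum_toReal (h0 ▸ measure_ne_top (μ x) (⋃ n, s n))
          rw [← ENNReal.tsum_toReal_eq (fun n => measure_ne_top (μ x) (s n)), ← h0] at h1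
          exact h1
        rw [HasSum, SummationFilter.unconditional_filter, tendsto_iff_norm_sub_tendsto_zero]
        rw [HasSum, SummationFilter.unconditional_filter] at hlim
        have h3 := (tendsto_const_nhds (x := (μ x).real (⋃ n, s n))).sub hlim
        rw [sub_self] at h3
        have h4 := (Real.continuous_sqrt.tendsto _).comp h3
        rw [Real.sqrt_zero] at h4
        refine h4.congr fun F => ?_
        simp only [Function.comp]
        rw [← key F, Real.sqrt_sq (norm_nonneg _)] }
  refine ⟨E, fun f hf x => ?_⟩
  have : E.diagMeasure x = μ x := by
    ext S hS
    rw [E.diagMeasure_apply x hS]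
    change ENNReal.ofReal (‖Q S x‖ ^ 2) = _
    rw [hQn S hS, ofReal_measureReal]
  rw [this, hμ x f hf]

/-- The projection-valued spectral measure `E_A` of a bounded self-adjoint operator `A`. -/
noncomputable def spectralMeasure (A : H →L[ℂ] H) (hA : IsSelfAdjoint A) :
    ProjectionValuedMeasure H :=
  (exists_isSpectralMeasure A hA).choose

theorem isSpectralMeasure_spectralMeasure (A : H →L[ℂ] H) (hA : IsSelfAdjoint A) :
    IsSpectralMeasure A (spectralMeasure A hA) :=
  (exists_isSpectralMeasure A hA).choose_spec

/-- `H_ε(A₁, …, A_N) = ⋂ᵢ E_{Aᵢ}([-ε, ε]) H`. -/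
noncomputable def spectralSubspace {N : ℕ} (A : Fin N → H →L[ℂ] H)
    (hA : ∀ i, IsSelfAdjoint (A i)) (ε : ℝ) : Submodule ℂ H :=
  ⨅ i, ((spectralMeasure (A i) (hA i)).proj (Set.Icc (-ε) ε)).range

/-- The algebraic sum of the ranges, `{∑ᵢ Aᵢ xᵢ | xᵢ ∈ H}`. -/
def sumRanges {N : ℕ} (A : Fin N → H →L[ℂ] H) : Submodule ℂ H :=
  ⨆ i, (A i).range

end SpectralTheory

/-!
Let `P i = 1 - E_{A i}([-ε, ε])`. Since `t⁻¹` is bounded off `[-ε, ε]`, `P i` factors through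
`A i` on either side, so `P i * P j` is compact for `i ≠ j`. Hence the summation map
`⨁ ran (P i) → H` is left invertible modulo compact operators, the adjoint being a left
parametrix. Its range is therefore closed; it has orthogonal complement `H_ε` and is contained in
`∑ ran (A i)`, so that `H_ε^⊥ ≤ ∑ ran (A i) ≤ H_0^⊥` and the two ends differ by `H_ε ⊖ H_0`.

Conversely, if `∑ ran (A i)` is closed, the open mapping theorem writes each of its elements as
`x = ∑ A i (y i)` with `‖y i‖ ≤ C ‖x‖`, and pairing with `x` gives `‖x‖ ≤ C ∑ ‖A i x‖`. On `H_ε`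
the right side is at most `N C ε ‖x‖`, which leaves only `x = 0` once `ε` is small.
-/

section LeftParametrix

variable {𝕜 E F : Type*} [RCLike 𝕜] [NormedAddCommGroup E] [NormedSpace 𝕜 E]
  [NormedAddCommGroup F] [NormedSpace 𝕜 F] {T : E →L[𝕜] F} {S : F →L[𝕜] E}

theorem exists_subseq_tendsto_of_isCompactOperator_comp_sub_one
    (h : IsCompactOperator (S ∘L T - 1 : E →L[𝕜] E)) {x : ℕ → E} {r : ℝ} (hx : ∀ n, ‖x n‖ ≤ r)
    (hT : Tendsto (fun n => T (x n)) atTop (𝓝 0)) :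
    ∃ y, ∃ φ : ℕ → ℕ, StrictMono φ ∧ Tendsto (x ∘ φ) atTop (𝓝 y) := by
  obtain ⟨C, hC, hsub⟩ :=
    h.image_closedBall_subset_compact (f := (S ∘L T - 1 : E →L[𝕜] E).toLinearMap) r
  obtain ⟨y, -, φ, hφ, hy⟩ := hC.tendsto_subseq (x := fun n => (S ∘L T - 1) (x n))
    fun n => hsub ⟨x n, by simp [hx n], rfl⟩
  have hST : Tendsto (fun n => S (T (x (φ n)))) atTop (𝓝 0) := by
    simpa only [map_zero, Function.comp_def] using
      (S.continuous.tendsto 0).comp (hT.comp hφ.tendsto_atTop)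
  refine ⟨0 - y, φ, hφ, (hST.sub hy).congr fun n => ?_⟩
  simp

theorem exists_antilipschitzWith_of_isCompactOperator_comp_sub_one
    (h : IsCompactOperator (S ∘L T - 1 : E →L[𝕜] E)) (hinj : Function.Injective T) :
    ∃ K, AntilipschitzWith K T := by
  rw [antilipschitzWith_iff_exists_mul_le_norm]
  by_contra! hcon
  have hunit (n : ℕ) : ∃ x, ‖x‖ = 1 ∧ ‖T x‖ < 1 / ((n : ℝ) + 1) := by
    obtain ⟨x, hx⟩ := hcon (1 / ((n : ℝ) + 1)) Nat.one_div_pos_of_nat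
    have hx0 : x ≠ 0 := by rintro rfl; simp at hx
    refine ⟨(‖x‖ : 𝕜)⁻¹ • x, norm_smul_inv_norm hx0, ?_⟩
    rwa [map_smul, norm_smul, norm_inv, RCLike.norm_ofReal, abs_norm,
      inv_mul_lt_iff₀ (norm_pos_iff.mpr hx0), mul_comm]
  choose x hx hTx using hunit
  have hT0 : Tendsto (fun n => T (x n)) atTop (𝓝 0) :=
    squeeze_zero_norm (fun n => (hTx n).le) tendsto_one_div_add_atTop_nhds_zero_nat
  obtain ⟨y, φ, hφ, hy⟩ :=
    exists_subseq_tendsto_of_isCompactOperator_comp_sub_one h (fun n => (hx n).le) hT0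
  have hTy : T y = 0 :=
    tendsto_nhds_unique ((T.continuous.tendsto y).comp hy) (hT0.comp hφ.tendsto_atTop)
  have hy1 : ‖y‖ = 1 := tendsto_nhds_unique hy.norm (by simp [hx])
  simp [(map_eq_zero_iff T hinj).mp hTy] at hy1

theorem finiteDimensional_ker_of_isCompactOperator_comp_sub_one
    (h : IsCompactOperator (S ∘L T - 1 : E →L[𝕜] E)) : FiniteDimensional 𝕜 T.ker := by
  have hneg (x : T.ker) : (S ∘L T - 1) (x : E) = -(x : E) := by
    simp [show T x = 0 from x.2]
  have hmem (x : T.ker) : (S ∘L T - 1) (x : E) ∈ T.ker := by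
    rw [hneg]
    exact neg_mem x.2
  have hres := ((h.comp_clm T.ker.subtypeL).codRestrict hmem T.isClosed_ker).neg
  have hid : (id : T.ker → T.ker) = -Set.codRestrict _ (T.ker : Set E) hmem :=
    funext fun x => Subtype.ext (by simp [hneg])
  exact FiniteDimensional.of_isCompactOperator_id (𝕜 := 𝕜) (hid ▸ hres)

theorem isClosed_range_of_isCompactOperator_comp_sub_one [CompleteSpace E]
    (h : IsCompactOperator (S ∘L T - 1 : E →L[𝕜] E)) : IsClosed (T.range : Set F) := by
  have := finiteDimensional_ker_of_isCompactOperator_comp_sub_one h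
  obtain ⟨M, hM⟩ :=
    (Submodule.ClosedComplemented.of_finiteDimensional T.ker).exists_isTopCompl
  have hMc : IsClosed (M : Set E) := hM.isClosed'
  let q : E →L[𝕜] M := M.projectionOntoL T.ker hM.symm
  let R : M →L[𝕜] F := T ∘L M.subtypeL
  have hRq (x : E) : R (q x) = T x := by
    have hker : T (T.ker.projectionL M hM x) = 0 := T.ker.projectionL_apply_mem hM x
    change T (M.projectionL T.ker hM.symm x) = T x
    rw [Submodule.projectionL_eq_self_sub_projectionL hM, map_sub, hker, sub_zero]
  have hinj : Function.Injective R := (injective_iff_map_eq_zero R).mpr fun x hx =>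
    Subtype.ext ((Submodule.disjoint_def.mp hM.isCompl.disjoint) x hx x.2)
  have heq : (q ∘L S) ∘L R - 1 = q ∘L (S ∘L T - 1) ∘L M.subtypeL := by
    ext x
    simp [R, q]
  have hcomp : IsCompactOperator ((q ∘L S) ∘L R - 1 : M →L[𝕜] M) :=
    heq ▸ (h.comp_clm M.subtypeL).clm_comp q
  obtain ⟨K, hK⟩ := exists_antilipschitzWith_of_isCompactOperator_comp_sub_one hcomp hinj
  have hrange : (T.range : Set F) = Set.range R :=
    Set.Subset.antisymm (Set.range_subset_iff.mpr fun x => ⟨q x, hRq x⟩)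
      (Set.range_comp_subset_range M.subtypeL T)
  have : CompleteSpace M := hMc.completeSpace_coe
  rw [hrange]
  exact hK.isClosed_range R.uniformContinuous

end LeftParametrix

section AlmostOrthogonalRanges

theorem isCompactOperator_pi {ι M : Type*} {X : ι → Type*} [Finite ι] [Zero M]
    [TopologicalSpace M] [∀ i, TopologicalSpace (X i)] {f : M → ∀ i, X i}
    (h : ∀ i, IsCompactOperator fun x => f x i) : IsCompactOperator f := by
  choose K hK hmem using h
  refine ⟨Set.univ.pi K, isCompact_univ_pi hK, ?_⟩
  filter_upwards [eventually_all.mpr hmem] with x hx i _ using hx i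

variable {𝕜 F ι : Type*} [RCLike 𝕜] [NormedAddCommGroup F] [NormedSpace 𝕜 F]

theorem range_sum_comp_proj [Fintype ι] {E : ι → Type*} [∀ i, NormedAddCommGroup (E i)]
    [∀ i, NormedSpace 𝕜 (E i)] (A : ∀ i, E i →L[𝕜] F) :
    (∑ i, A i ∘L ContinuousLinearMap.proj i : (∀ i, E i) →L[𝕜] F).range = ⨆ i, (A i).range := by
  classical
  apply le_antisymm
  · rintro _ ⟨x, rfl⟩
    simpa using Submodule.sum_mem (⨆ i, (A i).range) fun i (_ : i ∈ Finset.univ) =>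
      Submodule.mem_iSup_of_mem i (LinearMap.mem_range_self (A i).toLinearMap (x i))
  · refine iSup_le fun i => ?_
    rintro _ ⟨x, rfl⟩
    refine ⟨Pi.single i x, ?_⟩
    simp only [ContinuousLinearMap.coe_coe, _root_.sum_apply, ContinuousLinearMap.comp_apply,
      ContinuousLinearMap.proj_apply]
    rw [Finset.sum_eq_single i] <;> simp +contextual

theorem isClosed_iSup_range_of_isCompactOperator_comp [Finite ι] {E : ι → Type*}
    [∀ i, NormedAddCommGroup (E i)] [∀ i, NormedSpace 𝕜 (E i)] [∀ i, CompleteSpace (E i)]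
    {A : ∀ i, E i →L[𝕜] F} {B : ∀ i, F →L[𝕜] E i}
    (hdiag : ∀ i, IsCompactOperator (B i ∘L A i - 1 : E i →L[𝕜] E i))
    (hoff : Pairwise fun i j => IsCompactOperator (B i ∘L A j)) :
    IsClosed ((⨆ i, (A i).range : Submodule 𝕜 F) : Set F) := by
  classical
  have := Fintype.ofFinite ι
  let π (i : ι) : (∀ i, E i) →L[𝕜] E i := ContinuousLinearMap.proj i
  let T : (∀ i, E i) →L[𝕜] F := ∑ i, A i ∘L π i
  let S : F →L[𝕜] ∀ i, E i := ContinuousLinearMap.pi B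
  have hcomponent (i : ι) : π i ∘L (S ∘L T - 1) =
      (B i ∘L A i - 1) ∘L π i + ∑ j ∈ Finset.univ.erase i, (B i ∘L A j) ∘L π j := by
    ext x
    simp [π, S, T, Finset.sum_erase_eq_sub]
  have hcomp : IsCompactOperator (S ∘L T - 1 : (∀ i, E i) →L[𝕜] ∀ i, E i) := by
    refine isCompactOperator_pi fun i => ?_
    have hsum : IsCompactOperator
        (∑ j ∈ Finset.univ.erase i, (B i ∘L A j) ∘L π j : (∀ i, E i) →L[𝕜] E i) :=
      (compactOperator (RingHom.id 𝕜) (∀ i, E i) (E i)).sum_mem fun j hj =>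
        (hoff (Finset.ne_of_mem_erase hj).symm).comp_clm (π j)
    have : IsCompactOperator (π i ∘L (S ∘L T - 1)) := by
      rw [hcomponent]
      exact ((hdiag i).comp_clm (π i)).add hsum
    exact this
  rw [← range_sum_comp_proj]
  exact isClosed_range_of_isCompactOperator_comp_sub_one hcomp

theorem isClosed_iSup_range_of_isCompactOperator_mul [Finite ι] [CompleteSpace F]
    {P : ι → F →L[𝕜] F} (hP : ∀ i, IsIdempotentElem (P i))
    (h : Pairwise fun i j => IsCompactOperator (P i * P j)) :
    IsClosed ((⨆ i, (P i).range : Submodule 𝕜 F) : Set F) := by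
  have hclosed (i : ι) : IsClosed ((P i).range : Set F) :=
    ContinuousLinearMap.IsIdempotentElem.isClosed_range (hP i)
  have (i : ι) : CompleteSpace (P i).range := (hclosed i).completeSpace_coe
  have hfix (i : ι) (x : (P i).range) : P i x = x :=
    (LinearMap.IsIdempotentElem.mem_range_iff
      (ContinuousLinearMap.IsIdempotentElem.toLinearMap (hP i))).mp x.2
  let Q (i : ι) : F →L[𝕜] (P i).range :=
    (P i).codRestrict (P i).range (LinearMap.mem_range_self (P i).toLinearMap)
  have hdiag (i : ι) : Q i ∘L (P i).range.subtypeL = 1 := by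
    ext x
    exact hfix i x
  have hoff : Pairwise fun i j => IsCompactOperator (Q i ∘L (P j).range.subtypeL) := by
    intro i j hij
    have heq : P i ∘ (P j).range.subtypeL = (P i * P j) ∘ (P j).range.subtypeL := by
      funext x
      simp [hfix]
    have hcomp : IsCompactOperator (P i ∘ (P j).range.subtypeL) :=
      heq ▸ (h hij).comp_clm (P j).range.subtypeL
    exact hcomp.codRestrict _ (hclosed i)
  have hsup := isClosed_iSup_range_of_isCompactOperator_comp (𝕜 := 𝕜)
    (fun i => by rw [hdiag, sub_self]; exact isCompactOperator_zero) hoff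
  simpa using hsup

end AlmostOrthogonalRanges

section SumRanges

variable {H : Type*} [NormedAddCommGroup H] [InnerProductSpace ℂ H] [CompleteSpace H] {N : ℕ}
  {A : Fin N → H →L[ℂ] H}

theorem orthogonal_sumRanges (hA : ∀ i, IsSelfAdjoint (A i)) :
    (sumRanges A)ᗮ = ⨅ i, (A i).ker := by
  rw [sumRanges, ← Submodule.iInf_orthogonal]
  refine iInf_congr fun i => ?_
  rw [ContinuousLinearMap.orthogonal_range, (hA i).adjoint_eq]

theorem sumRanges_eq_orthogonal (hA : ∀ i, IsSelfAdjoint (A i))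
    (h : IsClosed (sumRanges A : Set H)) : sumRanges A = (⨅ i, (A i).ker)ᗮ := by
  have : CompleteSpace (sumRanges A) := h.completeSpace_coe
  rw [← orthogonal_sumRanges hA, Submodule.orthogonal_orthogonal]

theorem exists_sum_apply_eq_norm_le_of_isClosed_sumRanges (h : IsClosed (sumRanges A : Set H)) :
    ∃ C > 0, ∀ x ∈ sumRanges A, ∃ y : Fin N → H, ∑ i, A i (y i) = x ∧ ‖y‖ ≤ C * ‖x‖ := by
  let T : (Fin N → H) →L[ℂ] H := ∑ i, A i ∘L ContinuousLinearMap.proj i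
  have hT : T.range = sumRanges A := range_sum_comp_proj A
  have : CompleteSpace T.range := (hT ▸ h).completeSpace_coe
  obtain ⟨C, hC, hbound⟩ := T.rangeRestrict.exists_preimage_norm_le
    T.toLinearMap.surjective_rangeRestrict
  refine ⟨C, hC, fun x hx => ?_⟩
  obtain ⟨y, hy, hyC⟩ := hbound ⟨x, hT ▸ hx⟩
  exact ⟨y, by simpa [T] using congrArg Subtype.val hy, hyC⟩

theorem exists_norm_le_sum_norm_apply_of_isClosed_sumRanges (hA : ∀ i, IsSelfAdjoint (A i))
    (h : IsClosed (sumRanges A : Set H)) :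
    ∃ C > 0, ∀ x ∈ sumRanges A, ‖x‖ ≤ C * ∑ i, ‖A i x‖ := by
  obtain ⟨C, hC, hbound⟩ := exists_sum_apply_eq_norm_le_of_isClosed_sumRanges h
  refine ⟨C, hC, fun x hx => ?_⟩
  obtain ⟨y, hy, hyC⟩ := hbound x hx
  have hinner : ⟪x, x⟫_ℂ = ∑ i, ⟪A i x, y i⟫_ℂ := by
    conv_lhs => rw [← hy, inner_sum, hy]
    exact Finset.sum_congr rfl fun i _ =>
      (ContinuousLinearMap.isSelfAdjoint_iff_isSymmetric.mp (hA i) x (y i)).symm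
  rcases (norm_nonneg x).eq_or_lt with hx0 | hx0
  · rw [← hx0]
    positivity
  refine le_of_mul_le_mul_right ?_ hx0
  calc ‖x‖ * ‖x‖ = ‖∑ i, ⟪A i x, y i⟫_ℂ‖ := by
        rw [← hinner, inner_self_eq_norm_sq_to_K]
        simp [pow_two]
    _ ≤ ∑ i, ‖A i x‖ * ‖y i‖ :=
        norm_sum_le_of_le _ fun i _ => norm_inner_le_norm (A i x) (y i)
    _ ≤ ∑ i, ‖A i x‖ * (C * ‖x‖) := by
        gcongr with i
        exact (norm_le_pi_norm y i).trans hyC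
    _ = C * (∑ i, ‖A i x‖) * ‖x‖ := by
        rw [← Finset.sum_mul]
        ring

end SumRanges

section SpectralProjections

variable {H : Type*} [NormedAddCommGroup H] [InnerProductSpace ℂ H] [CompleteSpace H]

namespace ProjectionValuedMeasure

variable (E : ProjectionValuedMeasure H) (x : H) {S S' : Set ℝ}

theorem diagMeasure_real (hS : MeasurableSet S) :
    (E.diagMeasure x).real S = ‖E.proj S x‖ ^ 2 := by
  rw [measureReal_def, E.diagMeasure_apply x hS, ENNReal.toReal_ofReal (sq_nonneg _)]

theorem diagMeasure_real_univ : (E.diagMeasure x).real Set.univ = ‖x‖ ^ 2 := by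
  rw [E.diagMeasure_real x MeasurableSet.univ, E.proj_univ, one_apply_eq_self]

theorem proj_apply_eq_zero_iff (hS : MeasurableSet S) :
    E.proj S x = 0 ↔ ∀ᵐ t ∂E.diagMeasure x, t ∉ S := by
  rw [← measure_eq_zero_iff_ae_notMem, ← measureReal_eq_zero_iff, E.diagMeasure_real x hS,
    sq_eq_zero_iff, norm_eq_zero]

theorem mem_range_proj_iff (hS : MeasurableSet S) :
    x ∈ (E.proj S).range ↔ ∀ᵐ t ∂E.diagMeasure x, t ∈ S := by
  obtain ⟨_, hP⟩ := isStarProjection_iff_eq_starProjection_range.mp (E.isStarProjection S hS)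
  rw [Submodule.mem_iff_norm_starProjection, ← hP, ← sq_eq_sq₀ (norm_nonneg _) (norm_nonneg _),
    ← E.diagMeasure_real x hS, ← E.diagMeasure_real_univ, ae_iff, ← measureReal_eq_zero_iff]
  have hcompl := measureReal_compl (μ := E.diagMeasure x) hS
  change _ ↔ (E.diagMeasure x).real Sᶜ = 0
  rw [hcompl, sub_eq_zero, eq_comm]

theorem range_proj_mono (hS : MeasurableSet S) (hS' : MeasurableSet S') (h : S ⊆ S') :
    (E.proj S).range ≤ (E.proj S').range := fun x hx =>
  (E.mem_range_proj_iff x hS').mpr (((E.mem_range_proj_iff x hS).mp hx).mono fun _ ht => h ht)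

theorem one_sub_proj_eq_star_mul {A C : H →L[ℂ] H} (hA : IsSelfAdjoint A)
    (hS : MeasurableSet S) (h : 1 - E.proj S = A * C) : 1 - E.proj S = star C * A := by
  rw [← (E.isStarProjection S hS).one_sub.isSelfAdjoint.star_eq, h, star_mul, hA.star_eq]

theorem orthogonal_range_one_sub_proj (hS : MeasurableSet S) :
    (1 - E.proj S).rangeᗮ = (E.proj S).range := by
  have hE := E.isStarProjection S hS
  rw [ContinuousLinearMap.orthogonal_range, hE.one_sub.isSelfAdjoint.adjoint_eq]
  exact (LinearMap.IsIdempotentElem.range_eq_ker_one_sub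
    (ContinuousLinearMap.IsIdempotentElem.toLinearMap hE.isIdempotentElem)).symm

end ProjectionValuedMeasure

namespace IsSpectralMeasure

variable {A : H →L[ℂ] H} {E : ProjectionValuedMeasure H}

theorem norm_cfc_apply_le (hE : IsSpectralMeasure A E) (hA : IsSelfAdjoint A) {f : ℝ → ℝ}
    (hf : Continuous f) {c : ℝ} (hc : 0 ≤ c) {x : H}
    (hfc : ∀ᵐ t ∂E.diagMeasure x, |f t| ≤ c) : ‖cfc f A x‖ ≤ c * ‖x‖ := by
  refine le_of_sq_le_sq ?_ (by positivity)
  calc ‖cfc f A x‖ ^ 2 = ∫ t, f t ^ 2 ∂E.diagMeasure x :=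
        norm_cfc_sq A (E.diagMeasure x) x (fun g hg => hE g hg x) hA f hf
    _ ≤ ∫ _, c ^ 2 ∂E.diagMeasure x :=
        integral_mono_of_nonneg (Eventually.of_forall fun t => sq_nonneg (f t))
          (integrable_const _) (hfc.mono fun t ht => sq_le_sq.mpr (ht.trans (le_abs_self c)))
    _ = (c * ‖x‖) ^ 2 := by
        rw [integral_const, E.diagMeasure_real_univ, smul_eq_mul, mul_pow, mul_comm]

theorem norm_apply_le (hE : IsSpectralMeasure A E) (hA : IsSelfAdjoint A) {ε : ℝ} (hε : 0 ≤ ε)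
    {x : H} (hx : x ∈ (E.proj (Set.Icc (-ε) ε)).range) : ‖A x‖ ≤ ε * ‖x‖ := by
  have habs : ∀ᵐ t ∂E.diagMeasure x, |id t| ≤ ε :=
    ((E.mem_range_proj_iff x measurableSet_Icc).mp hx).mono fun t ht => abs_le.mpr ht
  simpa only [cfc_id ℝ A] using hE.norm_cfc_apply_le hA continuous_id hε habs

theorem exists_one_sub_proj_eq_mul (hE : IsSpectralMeasure A E) (hA : IsSelfAdjoint A)
    {ε : ℝ} (hε : 0 < ε) : ∃ C : H →L[ℂ] H, 1 - E.proj (Set.Icc (-ε) ε) = A * C := by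
  -- A continuous function agreeing with `t⁻¹` off `(-ε, ε)`.
  let h : ℝ → ℝ := fun t => t / max (t ^ 2) (ε ^ 2)
  have hh : Continuous h := continuous_id.div (by fun_prop) fun t => by positivity
  have hinv {t : ℝ} (ht : t ∉ Set.Icc (-ε) ε) : 1 - t * h t = 0 := by
    have hεt : ε < |t| := by rwa [Set.mem_Icc, ← abs_le, not_le] at ht
    have ht0 : t ≠ 0 := abs_pos.mp (hε.trans hεt)
    have hmax : max (t ^ 2) (ε ^ 2) = t ^ 2 := max_eq_left (sq_abs t ▸ by gcongr)
    simp only [h, hmax]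
    field_simp
    simp
  have hcfc : cfc (fun t => 1 - t * h t) A = 1 - A * cfc h A := by
    rw [cfc_sub (fun _ => (1 : ℝ)) (fun t => t * h t) A continuousOn_const (by fun_prop),
      cfc_mul (fun t => t) h A continuousOn_id hh.continuousOn, cfc_id' ℝ A, cfc_const_one ℝ A]
  refine ⟨cfc h A * (1 - E.proj (Set.Icc (-ε) ε)), ?_⟩
  ext x
  set y := (1 - E.proj (Set.Icc (-ε) ε)) x with hy
  have hEy : E.proj (Set.Icc (-ε) ε) y = 0 := by
    have hidem := (E.isStarProjection _ (measurableSet_Icc (a := -ε) (b := ε))).isIdempotentElem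
    rw [hy, ← mul_apply_eq_comp, hidem.mul_one_sub_self, zero_apply]
  have hae : ∀ᵐ t ∂E.diagMeasure y, |1 - t * h t| ≤ 0 :=
    ((E.proj_apply_eq_zero_iff y measurableSet_Icc).mp hEy).mono fun t ht => by simp [hinv ht]
  have hzero := hE.norm_cfc_apply_le hA (by fun_prop) le_rfl hae
  rw [hcfc, zero_mul, norm_le_zero_iff] at hzero
  exact sub_eq_zero.mp hzero

theorem ker_le_range_proj (hE : IsSpectralMeasure A E) (hA : IsSelfAdjoint A) {ε : ℝ}
    (hε : 0 < ε) : A.ker ≤ (E.proj (Set.Icc (-ε) ε)).range := by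
  obtain ⟨C, hC⟩ := hE.exists_one_sub_proj_eq_mul hA hε
  intro x hx
  have hx0 : (1 - E.proj (Set.Icc (-ε) ε)) x = 0 := by
    rw [E.one_sub_proj_eq_star_mul hA measurableSet_Icc hC, mul_apply_eq_comp,
      show A x = 0 from hx, map_zero]
  exact ⟨x, (sub_eq_zero.mp hx0).symm⟩

theorem range_proj_zero (hE : IsSpectralMeasure A E) (hA : IsSelfAdjoint A) :
    (E.proj (Set.Icc (-0) 0)).range = A.ker := by
  apply le_antisymm
  · intro x hx
    simpa using hE.norm_apply_le hA le_rfl hx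
  · intro x hx
    have hae (n : ℕ) : ∀ᵐ t ∂E.diagMeasure x, |t| ≤ 1 / ((n : ℝ) + 1) :=
      ((E.mem_range_proj_iff x measurableSet_Icc).mp
        (hE.ker_le_range_proj hA Nat.one_div_pos_of_nat hx)).mono fun t ht => abs_le.mpr ht
    rw [E.mem_range_proj_iff x measurableSet_Icc]
    filter_upwards [ae_all_iff.mpr hae] with t ht
    exact abs_le.mp (ge_of_tendsto' tendsto_one_div_add_atTop_nhds_zero_nat ht)

end IsSpectralMeasure

end SpectralProjections

section SpectralSubspace

theorem isClosed_of_le_sup_finiteDimensional {𝕜 E : Type*} [NontriviallyNormedField 𝕜]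
    [CompleteSpace 𝕜] [AddCommGroup E] [TopologicalSpace E] [IsTopologicalAddGroup E]
    [Module 𝕜 E] [ContinuousSMul 𝕜 E] {M R V : Submodule 𝕜 E} [FiniteDimensional 𝕜 V]
    (hM : IsClosed (M : Set E)) (hMR : M ≤ R) (hRV : R ≤ M ⊔ V) : IsClosed (R : Set E) := by
  have hmod : R = M ⊔ V ⊓ R := by
    rw [← sup_inf_assoc_of_le V hMR, inf_eq_right.mpr hRV]
  have : FiniteDimensional 𝕜 ↥(V ⊓ R) := Submodule.finiteDimensional_of_le inf_le_left
  rw [hmod]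
  exact M.isClosed_sup_finiteDimensional (V ⊓ R) hM

variable {H : Type*} [NormedAddCommGroup H] [InnerProductSpace ℂ H] [CompleteSpace H] {N : ℕ}
  (A : Fin N → H →L[ℂ] H) (hA : ∀ i, IsSelfAdjoint (A i))

theorem spectralSubspace_zero : spectralSubspace A hA 0 = ⨅ i, (A i).ker :=
  iInf_congr fun i => (isSpectralMeasure_spectralMeasure (A i) (hA i)).range_proj_zero (hA i)

theorem spectralSubspace_mono : Monotone (spectralSubspace A hA) := fun _ _ h =>
  iInf_mono fun i => (spectralMeasure (A i) (hA i)).range_proj_mono measurableSet_Icc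
    measurableSet_Icc (Set.Icc_subset_Icc (neg_le_neg h) h)

theorem isClosed_spectralSubspace (ε : ℝ) : IsClosed (spectralSubspace A hA ε : Set H) := by
  rw [spectralSubspace, Submodule.coe_iInf]
  exact isClosed_iInter fun i => ContinuousLinearMap.IsIdempotentElem.isClosed_range
    ((spectralMeasure (A i) (hA i)).isStarProjection _ measurableSet_Icc).isIdempotentElem

theorem norm_apply_le_of_mem_spectralSubspace {ε : ℝ} (hε : 0 ≤ ε) {x : H}
    (hx : x ∈ spectralSubspace A hA ε) (i : Fin N) : ‖A i x‖ ≤ ε * ‖x‖ :=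
  (isSpectralMeasure_spectralMeasure (A i) (hA i)).norm_apply_le (hA i) hε
    ((Submodule.mem_iInf _).mp hx i)

theorem spectralSubspace_eq_orthogonal_iSup (ε : ℝ) : spectralSubspace A hA ε =
    (⨆ i, (1 - (spectralMeasure (A i) (hA i)).proj (Set.Icc (-ε) ε)).range)ᗮ := by
  rw [← Submodule.iInf_orthogonal]
  exact iInf_congr fun i =>
    ((spectralMeasure (A i) (hA i)).orthogonal_range_one_sub_proj measurableSet_Icc).symm

theorem orthogonal_spectralSubspace_le_sumRanges
    (hcomp : ∀ i j, i ≠ j → IsCompactOperator (A i * A j)) {ε : ℝ} (hε : 0 < ε) :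
    (spectralSubspace A hA ε)ᗮ ≤ sumRanges A := by
  let P (i : Fin N) : H →L[ℂ] H := 1 - (spectralMeasure (A i) (hA i)).proj (Set.Icc (-ε) ε)
  have hP (i : Fin N) : IsIdempotentElem (P i) :=
    ((spectralMeasure (A i) (hA i)).isStarProjection _ measurableSet_Icc).isIdempotentElem.one_sub
  choose C hC using fun i =>
    (isSpectralMeasure_spectralMeasure (A i) (hA i)).exists_one_sub_proj_eq_mul (hA i) hε
  have hCstar (i : Fin N) : P i = star (C i) * A i :=
    (spectralMeasure (A i) (hA i)).one_sub_proj_eq_star_mul (hA i) measurableSet_Icc (hC i)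
  have hoff : Pairwise fun i j => IsCompactOperator (P i * P j) := by
    intro i j hij
    rw [hCstar i, show P j = A j * C j from hC j]
    exact ((hcomp i j hij).comp_clm (C j)).clm_comp (star (C i))
  have : CompleteSpace (⨆ i, (P i).range : Submodule ℂ H) :=
    (isClosed_iSup_range_of_isCompactOperator_mul hP hoff).completeSpace_coe
  rw [spectralSubspace_eq_orthogonal_iSup, Submodule.orthogonal_orthogonal]
  refine iSup_mono fun i => ?_
  rw [hC]
  exact LinearMap.range_comp_le_range (C i).toLinearMap (A i).toLinearMap

theorem orthogonal_spectralSubspace_sup_inf_orthogonal {ε : ℝ} (hε : 0 ≤ ε) :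
    (spectralSubspace A hA ε)ᗮ ⊔ spectralSubspace A hA ε ⊓ (spectralSubspace A hA 0)ᗮ =
      (spectralSubspace A hA 0)ᗮ := by
  have : CompleteSpace (spectralSubspace A hA ε) :=
    (isClosed_spectralSubspace A hA ε).completeSpace_coe
  simpa only [Submodule.orthogonal_orthogonal] using
    Submodule.sup_orthogonal_inf_of_hasOrthogonalProjection
      (Submodule.orthogonal_le (spectralSubspace_mono A hA hε))

theorem isClosed_sumRanges_of_finiteDimensional
    (hcomp : ∀ i j, i ≠ j → IsCompactOperator (A i * A j)) {ε : ℝ} (hε : 0 < ε)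
    [FiniteDimensional ℂ ↥(spectralSubspace A hA ε ⊓ (spectralSubspace A hA 0)ᗮ)] :
    IsClosed (sumRanges A : Set H) := by
  refine isClosed_of_le_sup_finiteDimensional
    (V := spectralSubspace A hA ε ⊓ (spectralSubspace A hA 0)ᗮ) (Submodule.isClosed_orthogonal _)
    (orthogonal_spectralSubspace_le_sumRanges A hA hcomp hε) ?_
  rw [orthogonal_spectralSubspace_sup_inf_orthogonal A hA hε.le, spectralSubspace_zero,
    ← orthogonal_sumRanges hA]
  exact Submodule.le_orthogonal_orthogonal _

theorem exists_spectralSubspace_inf_orthogonal_eq_bot (h : IsClosed (sumRanges A : Set H)) :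
    ∃ ε > 0, spectralSubspace A hA ε ⊓ (spectralSubspace A hA 0)ᗮ = ⊥ := by
  obtain ⟨C, hC, hbound⟩ := exists_norm_le_sum_norm_apply_of_isClosed_sumRanges hA h
  have hpos : 0 < N * C + 1 := by positivity
  have hε : 0 < 1 / (N * C + 1) := by positivity
  refine ⟨1 / (N * C + 1), hε, (Submodule.eq_bot_iff _).mpr ?_⟩
  rintro x ⟨hxε, hx0⟩
  rw [SetLike.mem_coe, spectralSubspace_zero, ← sumRanges_eq_orthogonal hA h] at hx0
  have hle : ‖x‖ ≤ N * C / (N * C + 1) * ‖x‖ := by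
    calc ‖x‖ ≤ C * ∑ i, ‖A i x‖ := hbound x hx0
      _ ≤ C * ∑ _ : Fin N, 1 / (N * C + 1) * ‖x‖ := by
          gcongr with i
          exact norm_apply_le_of_mem_spectralSubspace A hA hε.le hxε i
      _ = N * C / (N * C + 1) * ‖x‖ := by
          rw [Finset.sum_const, Finset.card_fin, nsmul_eq_mul]
          ring
  have hlt : N * C / (N * C + 1) < 1 := (div_lt_one hpos).mpr (lt_add_one _)
  by_contra hne
  exact hle.not_gt (mul_lt_of_lt_one_left (norm_pos_iff.mpr hne) hlt)

theorem exists_spectralSubspace_eq_of_isClosed_sumRanges (h : IsClosed (sumRanges A : Set H)) :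
    ∃ ε > 0, spectralSubspace A hA ε = spectralSubspace A hA 0 := by
  obtain ⟨ε, hε, hbot⟩ := exists_spectralSubspace_inf_orthogonal_eq_bot A hA h
  have : CompleteSpace (spectralSubspace A hA 0) :=
    (isClosed_spectralSubspace A hA 0).completeSpace_coe
  have hsup := Submodule.sup_orthogonal_inf_of_hasOrthogonalProjection
    (spectralSubspace_mono A hA hε.le)
  rw [inf_comm, hbot, sup_bot_eq] at hsup
  exact ⟨ε, hε, hsup.symm⟩

end SpectralSubspace

theorem theorem1p1 {H : Type*} [NormedAddCommGroup H] [InnerProductSpace ℂ H] [CompleteSpace H]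
    {N : ℕ} (hN : 2 ≤ N) (A : Fin N → H →L[ℂ] H) (hA : ∀ i, IsSelfAdjoint (A i))
    (hcomp : ∀ i j, i ≠ j → IsCompactOperator (A i * A j)) :
    spectralSubspace A hA 0 = ⨅ i, (A i).ker ∧
    (IsClosed (sumRanges A : Set H) ↔
      ∃ ε : ℝ, 0 < ε ∧ spectralSubspace A hA ε = spectralSubspace A hA 0) ∧
    ((∃ ε : ℝ, 0 < ε ∧
        FiniteDimensional ℂ ↥(spectralSubspace A hA ε ⊓ (spectralSubspace A hA 0)ᗮ)) →
      IsClosed (sumRanges A : Set H)) ∧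
    (IsClosed (sumRanges A : Set H) → sumRanges A = (spectralSubspace A hA 0)ᗮ) := by
  refine ⟨spectralSubspace_zero A hA,
    ⟨exists_spectralSubspace_eq_of_isClosed_sumRanges A hA, ?_⟩, ?_, fun h => ?_⟩
  · rintro ⟨ε, hε, heq⟩
    have : FiniteDimensional ℂ ↥(spectralSubspace A hA ε ⊓ (spectralSubspace A hA 0)ᗮ) := by
      rw [heq, Submodule.inf_orthogonal_eq_bot]
      infer_instance
    exact isClosed_sumRanges_of_finiteDimensional A hA hcomp hε
  · rintro ⟨ε, hε, hfin⟩
    exact isClosed_sumRanges_of_finiteDimensional A hA hcomp hε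
  · rw [spectralSubspace_zero]
    exact sumRanges_eq_orthogonal hA h
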